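/- Fix $P,\sigma>0$ and exponents $0\le p\le 1$, $0\le r<1$. For every integer $M\ge 1$ consider a satellite with a uniform linear array of $M$ antennas at altitude $H=H_M>0$ and cell size $R=R_M$ with $R/H=M^{-r}$, serving $K=K_M=M^p$ users ($M^p$ being rounded, up or down, to an adjacent integer when it is not an integer). The spatial frequencies $u_1,\dots,u_K$ of the users are i.i.d. uniform on $[-\frac{R}{2H},\frac{R}{2H}]$, and the channel of user $k$ is $\mathbf h_k=\sqrt M\,\mathbf a(u_k;M)\in\mathbb C^M$, where $\mathbf a(x;M)=\frac1{\sqrt M}[1,e^{j2\pi x},\dots,e^{j2\pi(M-1)x}]^{\mathsf T}$. With $\mathbf H=[\mathbf h_1,\dots,\mathbf h_K]$, let $\mathbf F=[\mathbf f_1,\dots,\mathbf f_K]=\eta\,\mathbf H(\mathbf H^{\mathsf H}\mathbf H)^{-1}$, $\eta=\operatorname{tr}((\mathbf H^{\mathsf H}\mathbf H)^{-1})^{-1/2}$, be the zero-forcing precoder, let $$\mathrm{SINR}_k=\frac{P|\mathbf h_k^{\mathsf H}\mathbf f_k|^2}{P\sum_{i\ne k}|\mathbf h_k^{\mathsf H}\mathbf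 f_i|^2+\sigma^2},$$ and let $$R_\Sigma=\sum_{k=1}^K\log_2(1+\mathrm{SINR}_k)=K\log_2\Big(1+\frac{\rho M}{\operatorname{tr}(\mathbf G^{-1})}\Big),\qquad \rho=\frac{P}{\sigma^2},\quad \mathbf G=\tfrac1M\mathbf H^{\mathsf H}\mathbf H,$$ be the sum rate (with $R_\Sigma=0$ on the null event that $\mathbf G$ is singular). Then $R_\Sigma$ is integrable for every $M\ge1$, and, as $M\to\infty$ with $P,\sigma,p,r$ fixed: (i) Sparse regime: if $p<1-r$, then $\mathbb E[R_\Sigma]=O(M^p\log M)$. (ii) Critical regime: if $p=1-r$, then there is a sequence $\varepsilon_M\to0$ such that $$\mathbb E[R_\Sigma]=\begin{cases}O\big(M^{r+\varepsilon_M}\big), & r<\frac12,\\ O\big(M^{1/2+\varepsilon_M}\big), & r=\frac12,\\ O\big(M^{1-r+\varepsilon_M}\log M\big), & r>\frac12.\end{cases}$$ (iii) Dense regime: if $p>1-r$, then $\mathbb E[R_\Sigma]\to0$. -/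

import Mathlib

open MeasureTheory ProbabilityTheory Filter Topology Asymptotics
open scoped Matrix

noncomputable section

namespace ZFDownlink

/-- Array response vector `a(x; M) = M^{-1/2} [1, e^{j2πx}, …, e^{j2π(M-1)x}]ᵀ` of a uniform
linear array with `M` antennas. -/
def response (M : ℕ) (x : ℝ) : Fin M → ℂ := fun m =>
  ((1 / Real.sqrt (M : ℝ) : ℝ) : ℂ) *
    Complex.exp (Complex.I * ((2 * Real.pi * ((m : ℕ) : ℝ) * x : ℝ) : ℂ))

/-- Line-of-sight channel matrix with unit path gains: its `k`-th column is
`h_k = √M a(u_k; M)`, where `u_k` is the spatial frequency of user `k`. -/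
def channel (M : ℕ) {K : ℕ} (u : Fin K → ℝ) : Matrix (Fin M) (Fin K) ℂ :=
  Matrix.of fun m k => ((Real.sqrt (M : ℝ) : ℝ) : ℂ) * response M (u k) m

/-- Power normalization `η = √(1 / tr((HᴴH)⁻¹))` of the zero-forcing precoder. -/
def zfScale {M K : ℕ} (H : Matrix (Fin M) (Fin K) ℂ) : ℝ :=
  Real.sqrt (1 / (((Hᴴ * H)⁻¹).trace).re)

/-- Zero-forcing precoding matrix `F = η H (HᴴH)⁻¹`. If `HᴴH` is singular, zero forcing is
impossible and this is the zero matrix (so that all rates vanish). -/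
def zfPrecoder {M K : ℕ} (H : Matrix (Fin M) (Fin K) ℂ) : Matrix (Fin M) (Fin K) ℂ :=
  ((zfScale H : ℝ) : ℂ) • (H * (Hᴴ * H)⁻¹)

/-- Signal-to-interference-plus-noise ratio of user `k` for transmit power `P`, noise power `σ²`,
channel matrix `H` and precoding matrix `F`; the entry `(HᴴF)_{k i}` is `h_kᴴ f_i`. -/
def sinr {M K : ℕ} (P σ : ℝ) (H F : Matrix (Fin M) (Fin K) ℂ) (k : Fin K) : ℝ :=
  P * ‖(Hᴴ * F) k k‖ ^ 2 /
    (P * (∑ i ∈ Finset.univ.erase k, ‖(Hᴴ * F) k i‖ ^ 2) + σ ^ 2)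

/-- Sum rate `R_Σ` under zero forcing for users at spatial frequencies `u`. -/
def zfSumRate (P σ : ℝ) (M : ℕ) {K : ℕ} (u : Fin K → ℝ) : ℝ :=
  ∑ k, Real.logb 2 (1 + sinr P σ (channel M u) (zfPrecoder (channel M u)) k)

/-- Average sum rate `𝔼[R_Σ]` for random spatial frequencies `u`. -/
def avgSumRate {Ω : Type*} [MeasurableSpace Ω] (μ : Measure Ω) (P σ : ℝ) (M : ℕ) {K : ℕ}
    (u : Fin K → Ω → ℝ) : ℝ :=
  ∫ ω, zfSumRate P σ M (fun k => u k ω) ∂μ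

/-- Channel Gram matrix `G = HᴴH / M`. -/
def gram (M : ℕ) {K : ℕ} (u : Fin K → ℝ) : Matrix (Fin K) (Fin K) ℂ :=
  ((M : ℂ)⁻¹) • ((channel M u)ᴴ * channel M u)

/-- The zero-forcing SINR of every user equals `ρ M / tr(G⁻¹)` with `ρ = P / σ²`. -/
theorem sinr_zf (P σ : ℝ) {M : ℕ} (hM : 1 ≤ M) {K : ℕ} (u : Fin K → ℝ) (k : Fin K) :
    sinr P σ (channel M u) (zfPrecoder (channel M u)) k =
      P / σ ^ 2 * M / (((gram M u)⁻¹).trace).re := by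
  have hM0 : (M : ℂ) ≠ 0 := by exact_mod_cast (by omega : M ≠ 0)
  have hM1 : (M : ℝ) ≠ 0 := by exact_mod_cast (by omega : M ≠ 0)
  have hg : ((gram M u)⁻¹) = (M : ℂ) • ((channel M u)ᴴ * channel M u)⁻¹ := by
    by_cases hd : IsUnit ((channel M u)ᴴ * channel M u).det
    · apply Matrix.inv_eq_right_inv
      rw [gram, Matrix.smul_mul, Matrix.mul_smul, smul_smul, inv_mul_cancel₀ hM0, one_smul,
        Matrix.mul_nonsing_inv _ hd]
    · have hd2 : ¬ IsUnit (gram M u).det := by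
        rw [gram, Matrix.det_smul]
        simp only [isUnit_iff_ne_zero, ne_eq, not_not] at hd ⊢
        rw [hd, mul_zero]
      rw [Matrix.nonsing_inv_apply_not_isUnit _ hd, Matrix.nonsing_inv_apply_not_isUnit _ hd2,
        smul_zero]
  rw [hg, Matrix.trace_smul, smul_eq_mul]
  generalize channel M u = H
  have hre : ((M : ℂ) * ((Hᴴ * H)⁻¹).trace).re = M * (((Hᴴ * H)⁻¹).trace).re := by
    simp
  rw [hre]
  by_cases hd : IsUnit (Hᴴ * H).det
  · have hF : Hᴴ * zfPrecoder H = ((zfScale H : ℝ) : ℂ) • (1 : Matrix (Fin K) (Fin K) ℂ) := by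
      rw [zfPrecoder, Matrix.mul_smul, ← Matrix.mul_assoc, Matrix.mul_nonsing_inv _ hd]
    have hpos : 0 ≤ (((Hᴴ * H)⁻¹).trace).re := by
      open scoped ComplexOrder in
      exact (Complex.le_def.1
        (Matrix.posSemidef_conjTranspose_mul_self H).inv.trace_nonneg).1
    have hz : (zfScale H) ^ 2 = 1 / (((Hᴴ * H)⁻¹).trace).re := by
      rw [zfScale, Real.sq_sqrt (by positivity)]
    have hoff : ∑ i ∈ Finset.univ.erase k, ‖(Hᴴ * zfPrecoder H) k i‖ ^ 2 = 0 := by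
      apply Finset.sum_eq_zero
      intro i hi
      rw [hF, Matrix.smul_apply, Matrix.one_apply_ne (Finset.ne_of_mem_erase hi).symm]
      simp
    rw [sinr, hoff, hF, Matrix.smul_apply, Matrix.one_apply_eq]
    simp only [smul_eq_mul, mul_one, Complex.norm_real, Real.norm_eq_abs, sq_abs, hz, mul_zero,
      zero_add]
    field_simp
  · rw [sinr, zfPrecoder, Matrix.nonsing_inv_apply_not_isUnit _ hd]
    simp

/-- Closed form of the sum rate: `R_Σ = K log₂(1 + ρ M / tr(G⁻¹))`. -/
theorem zfSumRate_eq (P σ : ℝ) {M : ℕ} (hM : 1 ≤ M) {K : ℕ} (u : Fin K → ℝ) :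
    zfSumRate P σ M u =
      K * Real.logb 2 (1 + P / σ ^ 2 * M / (((gram M u)⁻¹).trace).re) := by
  simp [zfSumRate, sinr_zf P σ hM]

end ZFDownlink

end

/-! ### Test-vector bounds on the rate. -/

namespace ZFDownlink

/-! With `A` the unit-column channel matrix, any vector `x` with `‖x‖ ≥ 1` certifies SINR `≤ ρ M
‖Ax‖²` (`snr_le`), so each regime reduces to a good choice of `x`. A basis vector gives `K log₂(1 +
ρM)` (`zfSumRate_le_logb`), which settles the sparse regime and the critical one for `r ≥ 1/2`. If
`n + 1` users lie within `w` of a point, an `x` annihilating the moments of degree below `n` cancels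
the Taylor head of the phases, and `‖Ax‖ ≤ (n+1) θ^n e^θ` with `θ = 2πMw`
(`exists_steering_mulVec_small`). In the dense regime, pigeonhole over slightly more than `M^(1-r)`
cells forces such a cluster for any fixed `n` once `M` is large; a large `n` beats every power of
`M` in front. In the critical regime with `r < 1/2`, a birthday argument with about `K² / log M`
cells puts two users in one cell except with probability `M⁻²`. Then `θ` is of order `log M / M^p`,
and `K M θ²` is of order `M^r (log M)²`; the logarithms go into `M^ε`. -/

/-- Trace bound behind every rate estimate: `‖x‖² ≤ tr((AᴴA)⁻¹) ‖Ax‖²`. -/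
theorem sum_sq_norm_le_trace_inv_mul {m n : Type*} [Fintype m] [Fintype n] [DecidableEq n]
    (A : Matrix m n ℂ) (h : IsUnit (Aᴴ * A).det) (x : n → ℂ) :
    ∑ k, ‖x k‖ ^ 2 ≤ (((Aᴴ * A)⁻¹).trace).re * ∑ i, ‖(A *ᵥ x) i‖ ^ 2 := by
  set N := (Aᴴ * A)⁻¹ with hN
  -- `Fᴴ` is the left pseudo-inverse of `A`: `Fᴴ A = 1` and `Fᴴ F = N`. Hence `tr N` is the squared
  -- Frobenius norm of `F`, and Cauchy–Schwarz applies to each coordinate of `x = Fᴴ (A x)`.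
  set F := A * N with hF
  have hherm : Nᴴ = N := by
    rw [hN, Matrix.conjTranspose_nonsing_inv, Matrix.conjTranspose_mul,
      Matrix.conjTranspose_conjTranspose]
  have hFA : Fᴴ * A = 1 := by
    rw [hF, Matrix.conjTranspose_mul, hherm, Matrix.mul_assoc, Matrix.nonsing_inv_mul _ h]
  have htr : N.trace.re = ∑ k, ∑ i, ‖F i k‖ ^ 2 := by
    have h1 : Fᴴ * F = N := by
      rw [hF, ← Matrix.mul_assoc, ← hF, hFA, Matrix.one_mul]
    rw [← h1, Matrix.trace, Complex.re_sum]
    refine Finset.sum_congr rfl fun k _ => ?_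
    rw [Matrix.diag_apply, Matrix.mul_apply, Complex.re_sum]
    refine Finset.sum_congr rfl fun i _ => ?_
    rw [Matrix.conjTranspose_apply, Complex.star_def, ← Complex.normSq_eq_conj_mul_self,
      Complex.ofReal_re, Complex.normSq_eq_norm_sq]
  rw [htr, Finset.sum_mul]
  refine Finset.sum_le_sum fun k _ => ?_
  have hx : x k = ∑ i, star (F i k) * (A *ᵥ x) i := by
    have h2 : Fᴴ *ᵥ (A *ᵥ x) = x := by rw [Matrix.mulVec_mulVec, hFA, Matrix.one_mulVec]
    conv_lhs => rw [← h2]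
    rfl
  calc ‖x k‖ ^ 2 ≤ (∑ i, ‖F i k‖ * ‖(A *ᵥ x) i‖) ^ 2 := by
        gcongr
        rw [hx]
        refine (norm_sum_le _ _).trans_eq ?_
        simp
    _ ≤ _ := Finset.sum_mul_sq_le_sq_mul_sq _ _ _

/-- The channel matrix normalized to unit columns, so that the Gram matrix is `AᴴA`. -/
noncomputable def steering (M : ℕ) {K : ℕ} (u : Fin K → ℝ) : Matrix (Fin M) (Fin K) ℂ :=
  Matrix.of fun m k => response M (u k) m

theorem gram_eq {M : ℕ} (hM : 1 ≤ M) {K : ℕ} (u : Fin K → ℝ) :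
    gram M u = (steering M u)ᴴ * steering M u := by
  have hc : channel M u = ((Real.sqrt (M : ℝ) : ℝ) : ℂ) • steering M u := rfl
  have hs : ((Real.sqrt (M : ℝ) : ℝ) : ℂ) * ((Real.sqrt (M : ℝ) : ℝ) : ℂ) = M := by
    rw [← Complex.ofReal_mul, Real.mul_self_sqrt (Nat.cast_nonneg M), Complex.ofReal_natCast]
  have hM0 : (M : ℂ) ≠ 0 := by exact_mod_cast (by omega : M ≠ 0)
  rw [gram, hc, Matrix.conjTranspose_smul, Matrix.smul_mul, Matrix.mul_smul, smul_smul, smul_smul,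
    Complex.star_def, Complex.conj_ofReal, mul_assoc, hs, inv_mul_cancel₀ hM0, one_smul]

theorem trace_inv_gram_nonneg {M : ℕ} (hM : 1 ≤ M) {K : ℕ} (u : Fin K → ℝ) :
    0 ≤ (((gram M u)⁻¹).trace).re := by
  rw [gram_eq hM]
  open scoped ComplexOrder in
  exact (Complex.le_def.1
    (Matrix.posSemidef_conjTranspose_mul_self (steering M u)).inv.trace_nonneg).1

theorem snr_le {M : ℕ} (hM : 1 ≤ M) {K : ℕ} (u : Fin K → ℝ) {ρ : ℝ} (hρ : 0 ≤ ρ)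
    (x : Fin K → ℂ) (hx : 1 ≤ ∑ k, ‖x k‖ ^ 2) :
    ρ * M / (((gram M u)⁻¹).trace).re ≤ ρ * M * ∑ m, ‖(steering M u *ᵥ x) m‖ ^ 2 := by
  have hE : 0 ≤ ∑ m, ‖(steering M u *ᵥ x) m‖ ^ 2 := by positivity
  by_cases hd : IsUnit ((steering M u)ᴴ * steering M u).det
  · have h := hx.trans (sum_sq_norm_le_trace_inv_mul _ hd x)
    rw [gram_eq hM]
    have hpos : 0 < ((((steering M u)ᴴ * steering M u)⁻¹).trace).re := by
      by_contra hneg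
      push Not at hneg
      nlinarith [mul_nonneg (neg_nonneg.2 hneg) hE]
    rw [div_le_iff₀ hpos, mul_assoc]
    exact le_mul_of_one_le_right (by positivity) (by rw [mul_comm]; exact h)
  -- A singular Gram matrix has inverse `0` by convention, and division by its zero trace makes the
  -- left side `0`.
  · rw [gram_eq hM, Matrix.nonsing_inv_apply_not_isUnit _ hd]
    simp only [Matrix.trace_zero, Complex.zero_re, div_zero]
    positivity

theorem zfSumRate_nonneg {P : ℝ} (hP : 0 ≤ P) (σ : ℝ) {M : ℕ} (hM : 1 ≤ M) {K : ℕ}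
    (u : Fin K → ℝ) : 0 ≤ zfSumRate P σ M u := by
  rw [zfSumRate_eq P σ hM]
  have := trace_inv_gram_nonneg hM u
  refine mul_nonneg (Nat.cast_nonneg K) (Real.logb_nonneg one_lt_two ?_)
  have : 0 ≤ P / σ ^ 2 * M / (((gram M u)⁻¹).trace).re := by positivity
  linarith

theorem zfSumRate_le {P : ℝ} (hP : 0 ≤ P) (σ : ℝ) {M : ℕ} (hM : 1 ≤ M) {K : ℕ}
    (u : Fin K → ℝ) (x : Fin K → ℂ) (hx : 1 ≤ ∑ k, ‖x k‖ ^ 2) :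
    zfSumRate P σ M u ≤
      K * Real.logb 2 (1 + P / σ ^ 2 * M * ∑ m, ‖(steering M u *ᵥ x) m‖ ^ 2) := by
  rw [zfSumRate_eq P σ hM]
  have := trace_inv_gram_nonneg hM u
  have h0 : 0 ≤ P / σ ^ 2 * M / (((gram M u)⁻¹).trace).re := by positivity
  have h1 := snr_le hM u (ρ := P / σ ^ 2) (by positivity) x hx
  gcongr
  · norm_num

theorem norm_response_sq {M : ℕ} (hM : 1 ≤ M) (x : ℝ) (m : Fin M) :
    ‖response M x m‖ ^ 2 = 1 / M := by
  have hM1 : (0 : ℝ) ≤ M := by positivity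
  rw [response, mul_comm Complex.I, norm_mul, Complex.norm_exp_ofReal_mul_I, mul_one,
    Complex.norm_real, Real.norm_eq_abs, sq_abs, div_pow, Real.sq_sqrt hM1, one_pow]

/-- Single-user bound on the sum rate. -/
theorem zfSumRate_le_logb {P : ℝ} (hP : 0 ≤ P) (σ : ℝ) {M : ℕ} (hM : 1 ≤ M) {K : ℕ}
    (u : Fin K → ℝ) :
    zfSumRate P σ M u ≤ K * Real.logb 2 (1 + P / σ ^ 2 * M) := by
  rcases Nat.eq_zero_or_pos K with rfl | hK
  · simp [zfSumRate]
  let k : Fin K := ⟨0, hK⟩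
  have hsum : ∑ m, ‖(steering M u *ᵥ Pi.single k (1 : ℂ)) m‖ ^ 2 = 1 := by
    have hM1 : (M : ℝ) ≠ 0 := by exact_mod_cast (by omega : M ≠ 0)
    simp only [Matrix.mulVec_single_one, Matrix.col_apply, steering, Matrix.of_apply,
      norm_response_sq hM]
    simp [hM1]
  have := zfSumRate_le hP σ hM u (Pi.single k 1) (by
    refine le_trans ?_ (Finset.single_le_sum (f := fun i => ‖(Pi.single k (1 : ℂ) : Fin K → ℂ) i‖ ^ 2)
      (fun i _ => by positivity) (Finset.mem_univ k))
    simp)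
  rwa [hsum, mul_one] at this

/-- Uses `log (1 + t) ≤ t`, which loses little when the energy `E` is small, as it is for clusters.
-/
theorem zfSumRate_le_linear {P : ℝ} (hP : 0 ≤ P) (σ : ℝ) {M : ℕ} (hM : 1 ≤ M) {K : ℕ}
    (u : Fin K → ℝ) (x : Fin K → ℂ) (hx : 1 ≤ ∑ k, ‖x k‖ ^ 2) {E : ℝ}
    (hE : ∑ m, ‖(steering M u *ᵥ x) m‖ ^ 2 ≤ E) :
    zfSumRate P σ M u ≤ K * (P / σ ^ 2 * M * E / Real.log 2) := by
  refine (zfSumRate_le hP σ hM u x hx).trans ?_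
  have h0 : 0 ≤ ∑ m, ‖(steering M u *ᵥ x) m‖ ^ 2 := by positivity
  have hE0 := h0.trans hE
  have h2 : 0 < Real.log 2 := Real.log_pos one_lt_two
  rw [Real.logb]
  gcongr
  have h3 : 0 ≤ P / σ ^ 2 * M * ∑ m, ‖(steering M u *ᵥ x) m‖ ^ 2 := by positivity
  have h4 := Real.log_le_sub_one_of_pos (show
    0 < 1 + P / σ ^ 2 * M * ∑ m, ‖(steering M u *ᵥ x) m‖ ^ 2 by linarith)
  have h5 : P / σ ^ 2 * M * ∑ m, ‖(steering M u *ᵥ x) m‖ ^ 2 ≤ P / σ ^ 2 * M * E := by gcongr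
  linarith

theorem measurable_zfSumRate (P σ : ℝ) {M : ℕ} (hM : 1 ≤ M) (K : ℕ) :
    Measurable fun u : Fin K → ℝ => zfSumRate P σ M u := by
  have hG : Continuous fun u : Fin K → ℝ => gram M u := by
    have hA : Continuous fun u : Fin K → ℝ => steering M u := by
      unfold steering response
      fun_prop
    simp only [gram_eq hM]
    exact hA.matrix_conjTranspose.matrix_mul hA
  have htr : Measurable fun u : Fin K → ℝ => (((gram M u)⁻¹).trace).re := by
    -- Inversion is not continuous at singular matrices; the adjugate formula is measurable
    -- everywhere, and `0⁻¹ = 0` matches the convention there.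
    have h : (fun u : Fin K → ℝ => (((gram M u)⁻¹).trace).re) = fun u =>
        (((gram M u).det)⁻¹ * ((gram M u).adjugate).trace).re := by
      funext u
      rw [Matrix.inv_def, Ring.inverse_eq_inv, Matrix.trace_smul, smul_eq_mul]
    rw [h]
    exact Complex.measurable_re.comp
      (hG.matrix_det.measurable.inv.mul hG.matrix_adjugate.matrix_trace.measurable)
  simp only [zfSumRate_eq P σ hM, Real.logb]
  exact ((Real.measurable_log.comp
    (measurable_const.add (measurable_const.div htr))).div_const _).const_mul _

/-! ### Clusters of users. -/

/-- Among `n + 1` complex numbers there is a bounded, nonzero combination annihilating all monomials of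
degree less than `n`. -/
theorem exists_vanishing_moments {K n : ℕ} (v : Fin K → ℂ) (S : Finset (Fin K))
    (hS : S.card = n + 1) :
    ∃ x : Fin K → ℂ, (∀ k, k ∉ S → x k = 0) ∧ (∀ k, ‖x k‖ ≤ 1) ∧ 1 ≤ ∑ k, ‖x k‖ ^ 2 ∧
      ∀ j < n, ∑ k ∈ S, x k * v k ^ j = 0 := by
  let V : Fin K → Fin n → ℂ := fun k j => v k ^ (j : ℕ)
  have hdep : ¬ LinearIndepOn ℂ V (S : Set (Fin K)) := by
    intro h
    have := LinearIndependent.fintype_card_le_finrank h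
    simp [hS] at this
  rw [linearIndepOn_finset_iff] at hdep
  push Not at hdep
  obtain ⟨g, hg, i, hi, hgi⟩ := hdep
  -- Dividing by the largest coefficient bounds all entries by 1 and makes one of them equal to 1.
  obtain ⟨k₀, hk₀, hmax⟩ := S.exists_max_image (fun k => ‖g k‖) ⟨i, hi⟩
  have hpos : 0 < ‖g k₀‖ := (norm_pos_iff.2 hgi).trans_le (hmax i hi)
  refine ⟨fun k => if k ∈ S then g k / g k₀ else 0, fun k hk => by simp [hk], fun k => ?_, ?_,
    fun j hj => ?_⟩
  · dsimp only
    split_ifs with hk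
    · rw [norm_div]
      exact (div_le_one hpos).2 (hmax k hk)
    · simp
  · refine le_trans ?_ (Finset.single_le_sum (fun k _ => by positivity) (Finset.mem_univ k₀))
    simp only [if_pos hk₀, div_self (norm_pos_iff.1 hpos), norm_one, one_pow, le_refl]
  · have h := congrFun hg ⟨j, hj⟩
    simp only [Finset.sum_apply, Pi.smul_apply, smul_eq_mul, Pi.zero_apply, V] at h
    have h2 : ∑ k ∈ S, (if k ∈ S then g k / g k₀ else 0) * v k ^ j =
        (∑ k ∈ S, g k * v k ^ j) / g k₀ := by
      rw [Finset.sum_div]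
      refine Finset.sum_congr rfl fun k hk => ?_
      rw [if_pos hk]
      ring
    rw [h2, h, zero_div]

/-- `n + 1` users with close spatial frequencies have nearly dependent channels. -/
theorem exists_steering_mulVec_small {M : ℕ} (hM : 1 ≤ M) {K n : ℕ} (u : Fin K → ℝ)
    (S : Finset (Fin K)) (hS : S.card = n + 1) {c w θ : ℝ} (hu : ∀ k ∈ S, |u k - c| ≤ w)
    (hθ : 2 * Real.pi * M * w ≤ θ) :
    ∃ x : Fin K → ℂ, 1 ≤ ∑ k, ‖x k‖ ^ 2 ∧
      ∑ m, ‖(steering M u *ᵥ x) m‖ ^ 2 ≤ ((n + 1) * (θ ^ n * Real.exp θ)) ^ 2 := by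
  obtain ⟨x, hx0, hx1, hx2, hmom⟩ := exists_vanishing_moments (fun k => ((u k - c : ℝ) : ℂ)) S hS
  refine ⟨x, hx2, ?_⟩
  have hM1 : (M : ℝ) ≠ 0 := by exact_mod_cast (by omega : M ≠ 0)
  have hpt : ∀ m : Fin M,
      ‖(steering M u *ᵥ x) m‖ ^ 2 ≤ 1 / M * ((n + 1) * (θ ^ n * Real.exp θ)) ^ 2 := by
    intro m
    let z : Fin K → ℂ := fun k =>
      (Complex.I * ((2 * Real.pi * ((m : ℕ) : ℝ) : ℝ) : ℂ)) * ((u k - c : ℝ) : ℂ)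
    have hz : ∀ k ∈ S, ‖z k‖ ≤ θ := by
      intro k hk
      have hw := hu k hk
      have hmM : ((m : ℕ) : ℝ) ≤ M := by exact_mod_cast m.2.le
      rw [norm_mul, norm_mul, Complex.norm_I, one_mul, Complex.norm_real, Complex.norm_real,
        Real.norm_of_nonneg (by positivity : (0 : ℝ) ≤ 2 * Real.pi * ((m : ℕ) : ℝ)),
        Real.norm_eq_abs]
      refine le_trans ?_ hθ
      gcongr
    -- Factoring out the response at the centre `c` leaves exponents `z k` of size at most `θ`.
    have hfac : (steering M u *ᵥ x) m = response M c m * ∑ k ∈ S, x k * Complex.exp (z k) := by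
      have h1 : (steering M u *ᵥ x) m = ∑ k ∈ S, response M (u k) m * x k := by
        refine (Finset.sum_subset (Finset.subset_univ S) fun k _ hk => ?_).symm
        rw [hx0 k hk, mul_zero]
      rw [h1, Finset.mul_sum]
      refine Finset.sum_congr rfl fun k _ => ?_
      have h2 : Complex.exp (Complex.I * ((2 * Real.pi * ((m : ℕ) : ℝ) * u k : ℝ) : ℂ)) =
          Complex.exp (Complex.I * ((2 * Real.pi * ((m : ℕ) : ℝ) * c : ℝ) : ℂ)) *
            Complex.exp (z k) := by
        rw [← Complex.exp_add]
        congr 1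
        simp only [z]
        push_cast
        ring
      rw [response, response, h2]
      ring
    -- The Taylor polynomial of degree below `n` combines monomials in `u k - c` that `x`
    -- annihilates, so only the remainder survives.
    have htaylor : ∑ k ∈ S, x k * Complex.exp (z k) =
        ∑ k ∈ S, x k * (Complex.exp (z k) -
          ∑ j ∈ Finset.range n, z k ^ j / (j.factorial : ℂ)) := by
      have h0 : ∑ k ∈ S, x k * ∑ j ∈ Finset.range n, z k ^ j / (j.factorial : ℂ) = 0 := by
        simp_rw [Finset.mul_sum]
        rw [Finset.sum_comm]
        refine Finset.sum_eq_zero fun j hj => ?_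
        have h3 : ∀ k, x k * (z k ^ j / (j.factorial : ℂ)) =
            (Complex.I * ((2 * Real.pi * ((m : ℕ) : ℝ) : ℝ) : ℂ)) ^ j / (j.factorial : ℂ) *
              (x k * ((u k - c : ℝ) : ℂ) ^ j) := by
          intro k
          simp only [z, mul_pow]
          ring
        simp_rw [h3]
        rw [← Finset.mul_sum, hmom j (Finset.mem_range.1 hj), mul_zero]
      simp_rw [mul_sub]
      rw [Finset.sum_sub_distrib, h0, sub_zero]
    have hnorm : ‖∑ k ∈ S, x k * Complex.exp (z k)‖ ≤ (n + 1) * (θ ^ n * Real.exp θ) := by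
      rw [htaylor]
      refine (norm_sum_le_of_le S (n := fun _ => θ ^ n * Real.exp θ) ?_).trans_eq ?_
      · intro k hk
        rw [norm_mul]
        have h4 := Complex.norm_exp_sub_sum_le_norm_mul_exp (z k) n
        have h5 : ‖z k‖ ^ n * Real.exp ‖z k‖ ≤ θ ^ n * Real.exp θ := by
          have hθ0 : 0 ≤ θ := (norm_nonneg _).trans (hz k hk)
          gcongr <;> exact hz k hk
        calc _ ≤ 1 * (θ ^ n * Real.exp θ) :=
              mul_le_mul (hx1 k) (h4.trans h5) (norm_nonneg _) zero_le_one
          _ = _ := one_mul _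
      · rw [Finset.sum_const, hS, nsmul_eq_mul]
        push_cast
        ring
    rw [hfac, norm_mul, mul_pow, norm_response_sq hM]
    gcongr
  calc ∑ m, ‖(steering M u *ᵥ x) m‖ ^ 2
      ≤ ∑ _m : Fin M, 1 / M * ((n + 1) * (θ ^ n * Real.exp θ)) ^ 2 :=
        Finset.sum_le_sum fun m _ => hpt m
    _ = ((n + 1) * (θ ^ n * Real.exp θ)) ^ 2 := by
        rw [Finset.sum_const, Finset.card_univ, Fintype.card_fin, nsmul_eq_mul]
        field_simp

theorem zfSumRate_le_of_cluster {P : ℝ} (hP : 0 ≤ P) (σ : ℝ) {M : ℕ} (hM : 1 ≤ M) {K n : ℕ}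
    (u : Fin K → ℝ) (S : Finset (Fin K)) (hS : n < S.card) {c w θ : ℝ}
    (hu : ∀ k ∈ S, |u k - c| ≤ w) (hθ : 2 * Real.pi * M * w ≤ θ) :
    zfSumRate P σ M u ≤
      K * (P / σ ^ 2 * M * ((n + 1) * (θ ^ n * Real.exp θ)) ^ 2 / Real.log 2) := by
  obtain ⟨T, hTS, hT⟩ := Finset.exists_subset_card_eq (Nat.succ_le_of_lt hS)
  obtain ⟨x, hx, hE⟩ := exists_steering_mulVec_small hM u T hT (fun k hk => hu k (hTS hk)) hθ
  exact zfSumRate_le_linear hP σ hM u x hx hE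

/-! ### Cells and the birthday estimate. -/

/-- The `b`-th of `B` equal cells of `[-W/2, W/2]`. -/
def cell (W : ℝ) (B b : ℕ) : Set ℝ :=
  Set.Icc (-(W / 2) + b * (W / B)) (-(W / 2) + (b + 1) * (W / B))

theorem exists_mem_cell {W : ℝ} (hW : 0 < W) {B : ℕ} (hB : 0 < B) {x : ℝ}
    (hx : x ∈ Set.Icc (-(W / 2)) (W / 2)) : ∃ b : Fin B, x ∈ cell W B b := by
  have hB' : (0 : ℝ) < B := by exact_mod_cast hB
  have hd : 0 < W / B := by positivity
  have hWd : W = B * (W / B) := by field_simp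
  set d := W / B with hd'
  set y := (x + W / 2) / d with hy
  have hyx : x = -(W / 2) + y * d := by rw [hy]; field_simp; ring
  have hy0 : 0 ≤ y := div_nonneg (by linarith [hx.1]) hd.le
  have hyB : y ≤ B := by
    rw [hy, div_le_iff₀ hd, ← hWd]
    linarith [hx.2]
  have hfin : ∃ b : Fin B, ((b : ℕ) : ℝ) ≤ y ∧ y ≤ ((b : ℕ) : ℝ) + 1 := by
    rcases hyB.lt_or_eq with h | h
    · exact ⟨⟨⌊y⌋₊, (Nat.floor_lt hy0).2 h⟩, Nat.floor_le hy0, (Nat.lt_floor_add_one y).le⟩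
    -- The right endpoint `W/2` has floor index `B`, so it is assigned to the last cell.
    · refine ⟨⟨B - 1, by omega⟩, ?_, ?_⟩ <;> simp only [h] <;> norm_cast <;> omega
  obtain ⟨b, h1, h2⟩ := hfin
  refine ⟨b, ?_, ?_⟩ <;> rw [← hd', hyx] <;> gcongr

theorem abs_sub_le_of_mem_cell {W : ℝ} {B b : ℕ} {x : ℝ} (hx : x ∈ cell W B b) :
    |x - (-(W / 2) + b * (W / B))| ≤ W / B := by
  rw [abs_of_nonneg (sub_nonneg.2 hx.1)]
  have := hx.2
  linarith

theorem zfSumRate_le_of_mem_cell {P : ℝ} (hP : 0 ≤ P) (σ : ℝ) {M : ℕ} (hM : 1 ≤ M) {K n : ℕ}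
    (u : Fin K → ℝ) {W θ : ℝ} {B : ℕ} (f : Fin K → Fin B) (hf : ∀ k, u k ∈ cell W B (f k))
    (hn : ∃ b, n < (Finset.univ.filter fun k => f k = b).card)
    (hθ : 2 * Real.pi * M * (W / B) ≤ θ) :
    zfSumRate P σ M u ≤
      K * (P / σ ^ 2 * M * ((n + 1) * (θ ^ n * Real.exp θ)) ^ 2 / Real.log 2) := by
  obtain ⟨b, hb⟩ := hn
  refine zfSumRate_le_of_cluster hP σ hM u _ hb (c := -(W / 2) + b * (W / B)) (w := W / B)
    (fun k hk => ?_) hθ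
  have hk' := (Finset.mem_filter.1 hk).2
  have := hf k
  rw [hk'] at this
  exact abs_sub_le_of_mem_cell this

/-- Birthday estimate. -/
theorem descFactorial_le_exp (B K : ℕ) :
    (B.descFactorial K : ℝ) ≤ B ^ K * Real.exp (-(K * (K - 1) / (2 * B))) := by
  induction K with
  | zero => simp
  | succ k ih =>
    rw [Nat.descFactorial_succ]
    rcases le_total B k with h | h
    · rw [Nat.sub_eq_zero_of_le h]
      simp only [zero_mul, Nat.cast_zero]
      positivity
    rcases Nat.eq_zero_or_pos B with rfl | hB
    · simp at h ⊢
    have hB' : (0 : ℝ) < B := by exact_mod_cast hB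
    -- Each new factor is `B (1 - k/B) ≤ B e^(-k/B)`; the exponents add up to `K(K-1)/(2B)`.
    have h1 : ((B - k : ℕ) : ℝ) ≤ B * Real.exp (-(k / B)) := by
      rw [Nat.cast_sub h]
      have := Real.one_sub_le_exp_neg ((k : ℝ) / B)
      calc (B : ℝ) - k = B * (1 - k / B) := by field_simp
        _ ≤ _ := by gcongr
    push_cast
    calc ((B - k : ℕ) : ℝ) * (B.descFactorial k : ℝ)
        ≤ (B * Real.exp (-(k / B))) * (B ^ k * Real.exp (-(k * (k - 1) / (2 * B)))) := by gcongr
      _ = B ^ (k + 1) * (Real.exp (-(k / B)) * Real.exp (-(k * (k - 1) / (2 * B)))) := by ring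
      _ = _ := by
        rw [← Real.exp_add]
        congr 2
        field_simp
        ring

/-! ### Averaging over the user positions. -/

section Probability

variable {Ω : Type*} [MeasurableSpace Ω] {μ : Measure Ω} {K : ℕ}
  {u : Fin K → Ω → ℝ} {W : ℝ}

theorem volume_Icc_half (W : ℝ) :
    volume (Set.Icc (-(W / 2)) (W / 2)) = ENNReal.ofReal W := by
  rw [Real.volume_Icc]
  congr 1
  ring

theorem IsUniform.aemeasurable_of_pos (hW : 0 < W) {X : Ω → ℝ}
    (h : pdf.IsUniform X (Set.Icc (-(W / 2)) (W / 2)) μ volume) : AEMeasurable X μ := by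
  refine pdf.IsUniform.aemeasurable ?_ ?_ h <;> rw [volume_Icc_half]
  · simpa using hW
  · exact ENNReal.ofReal_ne_top

theorem IsUniform.ae_mem_Icc (hW : 0 < W) {X : Ω → ℝ}
    (h : pdf.IsUniform X (Set.Icc (-(W / 2)) (W / 2)) μ volume) :
    ∀ᵐ ω ∂μ, X ω ∈ Set.Icc (-(W / 2)) (W / 2) := by
  have h1 : μ (X ⁻¹' (Set.Icc (-(W / 2)) (W / 2))ᶜ) = 0 := by
    rw [pdf.IsUniform.measure_preimage _ _ h measurableSet_Icc.compl]
    · simp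
    · rw [volume_Icc_half]; simpa using hW
    · rw [volume_Icc_half]; exact ENNReal.ofReal_ne_top
  exact h1

theorem IsUniform.measure_cell_le (hW : 0 < W) {X : Ω → ℝ}
    (h : pdf.IsUniform X (Set.Icc (-(W / 2)) (W / 2)) μ volume) {B : ℕ} (hB : 0 < B) (b : ℕ) :
    μ (X ⁻¹' cell W B b) ≤ ENNReal.ofReal (1 / B) := by
  have hB' : (0 : ℝ) < B := by exact_mod_cast hB
  have hvol : volume (cell W B b) = ENNReal.ofReal (W / B) := by
    rw [cell, Real.volume_Icc]
    congr 1
    ring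
  rw [pdf.IsUniform.measure_preimage (A := cell W B b) _ _ h measurableSet_Icc]
  · rw [volume_Icc_half]
    calc _ ≤ ENNReal.ofReal (W / B) / ENNReal.ofReal W := by
          gcongr
          rw [← hvol]
          exact measure_mono Set.inter_subset_right
      _ = _ := by
          rw [← ENNReal.ofReal_div_of_pos hW]
          congr 1
          field_simp
  · rw [volume_Icc_half]; simpa using hW
  · rw [volume_Icc_half]; exact ENNReal.ofReal_ne_top

/-- The event that the users occupy pairwise distinct cells. -/
def distinctCells (u : Fin K → Ω → ℝ) (W : ℝ) (B : ℕ) : Set Ω :=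
  ⋃ f : Fin K ↪ Fin B, ⋂ k ∈ Finset.univ, u k ⁻¹' cell W B (f k)

theorem measure_distinctCells_le (hW : 0 < W) (hindep : iIndepFun u μ)
    (hunif : ∀ k, pdf.IsUniform (u k) (Set.Icc (-(W / 2)) (W / 2)) μ volume) {B : ℕ}
    (hB : 0 < B) :
    μ (distinctCells u W B) ≤ ENNReal.ofReal (Real.exp (-(K * (K - 1) / (2 * B)))) := by
  have hB' : (0 : ℝ) < B := by exact_mod_cast hB
  have h1 : ∀ f : Fin K ↪ Fin B,
      μ (⋂ k ∈ Finset.univ, u k ⁻¹' cell W B (f k)) ≤ ENNReal.ofReal (1 / B) ^ K := by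
    intro f
    rw [hindep.measure_inter_preimage_eq_mul Finset.univ (sets := fun k => cell W B (f k))
      fun k _ => measurableSet_Icc]
    refine (Finset.prod_le_pow_card _ _ _ fun k _ =>
      IsUniform.measure_cell_le hW (hunif k) hB (f k)).trans_eq ?_
    simp
  calc μ (distinctCells u W B)
      ≤ ∑ f : Fin K ↪ Fin B, μ (⋂ k ∈ Finset.univ, u k ⁻¹' cell W B (f k)) :=
        measure_iUnion_fintype_le _ _
    _ ≤ ∑ _f : Fin K ↪ Fin B, ENNReal.ofReal (1 / B) ^ K := Finset.sum_le_sum fun f _ => h1 f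
    _ = ENNReal.ofReal (B.descFactorial K * (1 / B) ^ K) := by
        rw [Finset.sum_const, Finset.card_univ, Fintype.card_embedding_eq, Fintype.card_fin,
          Fintype.card_fin, nsmul_eq_mul, ENNReal.ofReal_mul (by positivity),
          ENNReal.ofReal_natCast, ENNReal.ofReal_pow (by positivity)]
    _ ≤ _ := by
        apply ENNReal.ofReal_le_ofReal
        have := descFactorial_le_exp B K
        rw [one_div, inv_pow, ← div_eq_mul_inv, div_le_iff₀ (by positivity)]
        linarith

theorem avgSumRate_nonneg {P : ℝ} (hP : 0 ≤ P) (σ : ℝ) {M : ℕ} (hM : 1 ≤ M) :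
    0 ≤ avgSumRate μ P σ M u :=
  integral_nonneg fun _ => zfSumRate_nonneg hP σ hM _

variable [IsProbabilityMeasure μ]

theorem integrable_zfSumRate {P : ℝ} (hP : 0 ≤ P) (σ : ℝ) {M : ℕ} (hM : 1 ≤ M) (hW : 0 < W)
    (hunif : ∀ k, pdf.IsUniform (u k) (Set.Icc (-(W / 2)) (W / 2)) μ volume) :
    Integrable (fun ω => zfSumRate P σ M (fun k => u k ω)) μ := by
  refine Integrable.of_bound ?_ (K * Real.logb 2 (1 + P / σ ^ 2 * M)) (ae_of_all _ fun ω => ?_)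
  · exact ((measurable_zfSumRate P σ hM K).comp_aemeasurable (aemeasurable_pi_lambda _
      fun k => IsUniform.aemeasurable_of_pos hW (hunif k))).aestronglyMeasurable
  · rw [Real.norm_of_nonneg (zfSumRate_nonneg hP σ hM _)]
    exact zfSumRate_le_logb hP σ hM _

theorem avgSumRate_le_logb {P : ℝ} (hP : 0 ≤ P) (σ : ℝ) {M : ℕ} (hM : 1 ≤ M) (hW : 0 < W)
    (hunif : ∀ k, pdf.IsUniform (u k) (Set.Icc (-(W / 2)) (W / 2)) μ volume) :
    avgSumRate μ P σ M u ≤ K * Real.logb 2 (1 + P / σ ^ 2 * M) := by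
  refine (integral_mono (integrable_zfSumRate hP σ hM hW hunif) (integrable_const _)
    fun ω => zfSumRate_le_logb hP σ hM _).trans_eq ?_
  simp

/-- If the users outnumber the cells `n` to one, some cell holds a cluster of `n + 1` users. -/
theorem avgSumRate_le_of_mul_lt {P : ℝ} (hP : 0 ≤ P) (σ : ℝ) {M : ℕ} (hM : 1 ≤ M) (hW : 0 < W)
    (hunif : ∀ k, pdf.IsUniform (u k) (Set.Icc (-(W / 2)) (W / 2)) μ volume) {B n : ℕ} {θ : ℝ}
    (hB : 0 < B) (hn : B * n < K) (hθ : 2 * Real.pi * M * (W / B) ≤ θ) :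
    avgSumRate μ P σ M u ≤
      K * (P / σ ^ 2 * M * ((n + 1) * (θ ^ n * Real.exp θ)) ^ 2 / Real.log 2) := by
  refine (integral_mono_ae (integrable_zfSumRate hP σ hM hW hunif) (integrable_const
    (K * (P / σ ^ 2 * M * ((n + 1) * (θ ^ n * Real.exp θ)) ^ 2 / Real.log 2))) ?_).trans_eq
    (by simp)
  filter_upwards [ae_all_iff.2 fun k => IsUniform.ae_mem_Icc hW (hunif k)] with ω hω
  choose f hf using fun k => exists_mem_cell hW hB (hω k)
  exact zfSumRate_le_of_mem_cell hP σ hM _ f hf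
    (Fintype.exists_lt_card_fiber_of_mul_lt_card f (by simpa using hn)) hθ

/-- Splitting according to whether two users share one of `B` cells. -/
theorem avgSumRate_le_of_cells {P : ℝ} (hP : 0 ≤ P) (σ : ℝ) {M : ℕ} (hM : 1 ≤ M) (hW : 0 < W)
    (hindep : iIndepFun u μ)
    (hunif : ∀ k, pdf.IsUniform (u k) (Set.Icc (-(W / 2)) (W / 2)) μ volume) {B : ℕ} {θ : ℝ}
    (hB : 0 < B) (hθ : 2 * Real.pi * M * (W / B) ≤ θ) :
    avgSumRate μ P σ M u ≤
      K * (P / σ ^ 2 * M * (2 * (θ * Real.exp θ)) ^ 2 / Real.log 2) +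
        K * Real.logb 2 (1 + P / σ ^ 2 * M) * Real.exp (-(K * (K - 1) / (2 * B))) := by
  set a := K * (P / σ ^ 2 * M * (2 * (θ * Real.exp θ)) ^ 2 / Real.log 2) with ha
  set b := K * Real.logb 2 (1 + P / σ ^ 2 * M) with hb
  -- The `u k` are only a.e. measurable, so the event is replaced by a measurable superset of equal
  -- measure.
  set T := toMeasurable μ (distinctCells u W B) with hT
  have hTm : MeasurableSet T := measurableSet_toMeasurable _ _
  have ha0 : 0 ≤ a := by
    have := Real.log_pos one_lt_two
    positivity
  have hb0 : 0 ≤ b := mul_nonneg (Nat.cast_nonneg K)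
    (Real.logb_nonneg one_lt_two (le_add_of_nonneg_right (by positivity)))
  have hTle : μ.real T ≤ Real.exp (-(K * (K - 1) / (2 * B))) := by
    rw [Measure.real, hT, measure_toMeasurable]
    exact ENNReal.toReal_le_of_le_ofReal (Real.exp_pos _).le
      (measure_distinctCells_le hW hindep hunif hB)
  have hint : Integrable (fun ω => a + T.indicator (fun _ => b) ω) μ :=
    (integrable_const a).add ((integrable_const b).indicator hTm)
  have hle : ∀ᵐ ω ∂μ, zfSumRate P σ M (fun k => u k ω) ≤ a + T.indicator (fun _ => b) ω := by
    filter_upwards [ae_all_iff.2 fun k => IsUniform.ae_mem_Icc hW (hunif k)] with ω hω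
    by_cases hωT : ω ∈ T
    · rw [Set.indicator_of_mem hωT]
      linarith [zfSumRate_le_logb hP σ hM fun k => u k ω]
    · rw [Set.indicator_of_notMem hωT, add_zero]
      choose f hf using fun k => exists_mem_cell hW hB (hω k)
      -- Closed cells share endpoints, but off `T` no admissible assignment is injective, whichever
      -- one was chosen.
      have hninj : ¬ Function.Injective f := fun hinj => hωT <|
        subset_toMeasurable _ _ <| Set.mem_iUnion.2
          ⟨⟨f, hinj⟩, Set.mem_iInter₂.2 fun k _ => hf k⟩
      simp only [Function.Injective, not_forall] at hninj
      obtain ⟨i, j, hij, hne⟩ := hninj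
      have hcard : 1 < (Finset.univ.filter fun k => f k = f j).card :=
        Finset.one_lt_card.2 ⟨i, by simp [hij], j, by simp, hne⟩
      refine (zfSumRate_le_of_mem_cell hP σ hM _ f hf ⟨f j, hcard⟩ hθ).trans_eq ?_
      rw [ha]
      norm_num
  calc avgSumRate μ P σ M u ≤ ∫ ω, (a + T.indicator (fun _ => b) ω) ∂μ :=
        integral_mono_ae (integrable_zfSumRate hP σ hM hW hunif) hint hle
    _ = a + μ.real T * b := by
        rw [integral_add (integrable_const a) ((integrable_const b).indicator hTm),
          integral_indicator_const b hTm]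
        simp
    _ ≤ a + b * Real.exp (-(K * (K - 1) / (2 * B))) := by
        rw [mul_comm]
        gcongr

end Probability

/-! ### Scaling laws. -/

/-- Logarithmic factors become `M^ε` with `ε = k log log M / log M`. -/
theorem exists_rpow_eq_log_pow (k : ℕ) :
    ∃ ε : ℕ → ℝ, Tendsto ε atTop (𝓝 0) ∧
      ∀ M : ℕ, 2 ≤ M → (M : ℝ) ^ ε M = Real.log M ^ k := by
  refine ⟨fun M => k * (Real.log (Real.log M) / Real.log M), ?_, fun M hM => ?_⟩
  · have h := (Real.isLittleO_log_id_atTop.tendsto_div_nhds_zero.comp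
      (Real.tendsto_log_atTop.comp tendsto_natCast_atTop_atTop)).const_mul (k : ℝ)
    simpa [Function.comp_def] using h
  · have hM' : (1 : ℝ) < M := by exact_mod_cast hM
    have hlog : 0 < Real.log M := Real.log_pos hM'
    rw [Real.rpow_def_of_pos (by linarith), ← Real.exp_log (pow_pos hlog k), Real.log_pow]
    congr 1
    field_simp

theorem natCast_le_two_mul_of_abs_sub_lt {K : ℕ} {x : ℝ} (hx : 1 ≤ x) (h : |(K : ℝ) - x| < 1) :
    (K : ℝ) ≤ 2 * x := by
  linarith [(abs_lt.1 h).2]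

theorem half_le_natCast_of_abs_sub_lt {K : ℕ} {x : ℝ} (hx : 2 ≤ x) (h : |(K : ℝ) - x| < 1) :
    x / 2 ≤ K := by
  linarith [(abs_lt.1 h).1]

theorem logb_one_add_mul_le {ρ : ℝ} (hρ : 0 ≤ ρ) {M : ℕ} (hM : 2 ≤ M) :
    Real.logb 2 (1 + ρ * M) ≤
      (Real.log (1 + ρ) / Real.log 2 + 1) / Real.log 2 * Real.log M := by
  have hM' : (2 : ℝ) ≤ M := by exact_mod_cast hM
  have h2 : 0 < Real.log 2 := Real.log_pos one_lt_two
  have h1 : Real.log (1 + ρ * M) ≤ Real.log (1 + ρ) + Real.log M := by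
    rw [← Real.log_mul (by positivity) (by positivity)]
    apply Real.log_le_log (by positivity)
    linarith
  have h3 : Real.log 2 ≤ Real.log M := Real.log_le_log two_pos hM'
  have h4 : 0 ≤ Real.log (1 + ρ) := Real.log_nonneg (by linarith)
  have h5 : Real.log (1 + ρ) ≤ Real.log (1 + ρ) / Real.log 2 * Real.log M := by
    rw [div_mul_eq_mul_div, le_div_iff₀ h2]
    gcongr
  rw [Real.logb, div_mul_eq_mul_div]
  gcongr
  linarith

section Scaling

variable {Ω : ℕ → Type*} [∀ M, MeasurableSpace (Ω M)]
  {μ : ∀ M, Measure (Ω M)} [∀ M, IsProbabilityMeasure (μ M)]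
  {P σ p r : ℝ} {K : ℕ → ℕ} {u : ∀ M : ℕ, Fin (K M) → Ω M → ℝ}

theorem avgSumRate_isBigO_rpow_mul_log (hP : 0 < P) (hp0 : 0 ≤ p)
    (hK : ∀ M : ℕ, 1 ≤ M → |(K M : ℝ) - (M : ℝ) ^ p| < 1)
    (hunif : ∀ M : ℕ, 1 ≤ M → ∀ k, pdf.IsUniform (u M k)
      (Set.Icc (-((M : ℝ) ^ (-r) / 2)) ((M : ℝ) ^ (-r) / 2)) (μ M) volume) :
    (fun M : ℕ => avgSumRate (μ M) P σ M (u M)) =O[atTop]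
      (fun M : ℕ => (M : ℝ) ^ p * Real.log M) := by
  set C := (Real.log (1 + P / σ ^ 2) / Real.log 2 + 1) / Real.log 2
  refine IsBigO.of_bound (2 * C) ?_
  filter_upwards [eventually_ge_atTop 2] with M hM
  have hM1 : 1 ≤ M := by omega
  have hM' : (1 : ℝ) ≤ M := by exact_mod_cast hM1
  have hlog : 0 ≤ Real.log M := Real.log_nonneg hM'
  rw [Real.norm_of_nonneg (avgSumRate_nonneg hP.le σ hM1), Real.norm_of_nonneg (by positivity)]
  have h1 := avgSumRate_le_logb hP.le σ hM1 (by positivity) (hunif M hM1)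
  have h2 := natCast_le_two_mul_of_abs_sub_lt (Real.one_le_rpow hM' hp0) (hK M hM1)
  have h3 := logb_one_add_mul_le (show 0 ≤ P / σ ^ 2 by positivity) hM
  calc _ ≤ _ := h1
    _ ≤ (2 * (M : ℝ) ^ p) * (C * Real.log M) :=
        mul_le_mul h2 h3 (Real.logb_nonneg one_lt_two (le_add_of_nonneg_right (by positivity)))
          (by positivity)
    _ = _ := by ring

theorem avgSumRate_tendsto_zero (hP : 0 < P) (hp1 : p ≤ 1) (hr1 : r < 1)
    (hpr : 1 - r < p)
    (hK : ∀ M : ℕ, 1 ≤ M → |(K M : ℝ) - (M : ℝ) ^ p| < 1)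
    (hunif : ∀ M : ℕ, 1 ≤ M → ∀ k, pdf.IsUniform (u M k)
      (Set.Icc (-((M : ℝ) ^ (-r) / 2)) ((M : ℝ) ^ (-r) / 2)) (μ M) volume) :
    Tendsto (fun M : ℕ => avgSumRate (μ M) P σ M (u M)) atTop (𝓝 0) := by
  -- Half of the excess `p - (1 - r)` makes cells narrow, `θ = 2π M^(-δ)`; the other half leaves
  -- about `M^δ` users per cell. With `nδ ≥ 2`, `θ^(2n)` is of order `M⁻⁴`, against a prefactor of
  -- order `KM ≤ 2M²`.
  obtain ⟨δ, hδ⟩ : ∃ δ, δ = (p - (1 - r)) / 2 := ⟨_, rfl⟩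
  have hδ0 : 0 < δ := by linarith
  obtain ⟨n, hn⟩ := exists_nat_ge (2 / δ)
  have hnδ : 2 ≤ δ * n := by rw [div_le_iff₀ hδ0] at hn; linarith
  have h2 : 0 < Real.log 2 := Real.log_pos one_lt_two
  set D : ℝ := (n + 1) * ((2 * Real.pi) ^ n * Real.exp (2 * Real.pi)) with hD
  set C : ℝ := 2 * (P / σ ^ 2 * D ^ 2 / Real.log 2) with hC
  have hlim : Tendsto (fun M : ℕ => C * (M : ℝ) ^ (-2 : ℝ)) atTop (𝓝 0) := by
    simpa using ((tendsto_rpow_neg_atTop two_pos).comp tendsto_natCast_atTop_atTop).const_mul C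
  refine tendsto_of_tendsto_of_tendsto_of_le_of_le' tendsto_const_nhds hlim ?_ ?_
  · filter_upwards [eventually_ge_atTop 1] with M hM using avgSumRate_nonneg hP.le σ hM
  have hevδ := ((tendsto_rpow_atTop hδ0).comp tendsto_natCast_atTop_atTop).eventually_gt_atTop
    (4 * n : ℝ)
  have hevp := ((tendsto_rpow_atTop (show 0 < p by linarith)).comp
    tendsto_natCast_atTop_atTop).eventually_ge_atTop 2
  filter_upwards [eventually_ge_atTop 1, hevδ, hevp] with M hM hMδ hMp
  simp only [Function.comp_apply] at hMδ hMp
  have hM' : (1 : ℝ) ≤ M := by exact_mod_cast hM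
  have hM0 : (0 : ℝ) < M := by linarith
  set x := (M : ℝ) ^ (1 - r + δ) with hx
  have hx1 : 1 ≤ x := Real.one_le_rpow hM' (by linarith)
  have hBx : x ≤ ⌈x⌉₊ := Nat.le_ceil x
  have hBx' : (⌈x⌉₊ : ℝ) ≤ 2 * x := by linarith [Nat.ceil_lt_add_one (by linarith : 0 ≤ x)]
  have hB : 0 < ⌈x⌉₊ := Nat.ceil_pos.2 (by linarith)
  have hKlow := half_le_natCast_of_abs_sub_lt hMp (hK M hM)
  have hKup := natCast_le_two_mul_of_abs_sub_lt (by linarith) (hK M hM)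
  have hpx : (M : ℝ) ^ p = x * (M : ℝ) ^ δ := by
    rw [hx, ← Real.rpow_add hM0]
    congr 1
    linarith
  have hpM : (M : ℝ) ^ p ≤ M := by
    simpa using Real.rpow_le_rpow_of_exponent_le hM' hp1
  have hBK : ⌈x⌉₊ * n < K M := by
    have : ((⌈x⌉₊ * n : ℕ) : ℝ) < K M := by
      push_cast
      calc (⌈x⌉₊ : ℝ) * n ≤ 2 * x * n := by gcongr
        _ = x * (4 * n) / 2 := by ring
        _ < x * (M : ℝ) ^ δ / 2 := by gcongr
        _ ≤ K M := by rw [← hpx]; exact hKlow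
    exact_mod_cast this
  set θ := 2 * Real.pi * (M : ℝ) ^ (-δ) with hθdef
  have hθ : 2 * Real.pi * M * ((M : ℝ) ^ (-r) / ⌈x⌉₊) ≤ θ := by
    calc 2 * Real.pi * M * ((M : ℝ) ^ (-r) / ⌈x⌉₊)
        ≤ 2 * Real.pi * M * ((M : ℝ) ^ (-r) / x) := by gcongr
      _ = θ := by
        have h3 : (M : ℝ) * ((M : ℝ) ^ (-r) / x) = (M : ℝ) ^ (-δ) := by
          rw [hx, ← Real.rpow_sub hM0]
          nth_rewrite 1 [← Real.rpow_one (M : ℝ)]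
          rw [← Real.rpow_add hM0]
          congr 1
          ring
        rw [mul_assoc, h3]
  have hθ0 : 0 ≤ θ := by positivity
  have hθle : θ ≤ 2 * Real.pi := by
    have : (M : ℝ) ^ (-δ) ≤ 1 := Real.rpow_le_one_of_one_le_of_nonpos hM' (by linarith)
    exact mul_le_of_le_one_right (by positivity) this
  have hθn : θ ^ n ≤ (2 * Real.pi) ^ n * (M : ℝ) ^ (-2 : ℝ) := by
    rw [hθdef, mul_pow, ← Real.rpow_natCast ((M : ℝ) ^ (-δ)), ← Real.rpow_mul hM0.le]
    gcongr
    linarith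
  have hpow : ((n + 1) * (θ ^ n * Real.exp θ)) ^ 2 ≤ (D * (M : ℝ) ^ (-2 : ℝ)) ^ 2 := by
    refine pow_le_pow_left₀ (by positivity) ?_ 2
    calc (n + 1) * (θ ^ n * Real.exp θ)
        ≤ (n + 1) * (((2 * Real.pi) ^ n * (M : ℝ) ^ (-2 : ℝ)) * Real.exp (2 * Real.pi)) := by
          gcongr
      _ = D * (M : ℝ) ^ (-2 : ℝ) := by rw [hD]; ring
  refine (avgSumRate_le_of_mul_lt hP.le σ hM (by positivity) (hunif M hM) hB hBK hθ).trans ?_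
  calc (K M : ℝ) * (P / σ ^ 2 * M * ((n + 1) * (θ ^ n * Real.exp θ)) ^ 2 / Real.log 2)
      ≤ (2 * M) * (P / σ ^ 2 * M * (D * (M : ℝ) ^ (-2 : ℝ)) ^ 2 / Real.log 2) := by
        gcongr
        linarith
    _ = C * (M : ℝ) ^ (-2 : ℝ) := by
        have h4 : (M : ℝ) ^ (-2 : ℝ) = ((M : ℝ) ^ 2)⁻¹ := by
          rw [Real.rpow_neg hM0.le]
          norm_num
        rw [h4, hC]
        field_simp

-- Valid throughout the critical regime, but it improves on the exponent `p = 1 - r` of the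
-- single-user bound only when `r < 1/2`.
set_option maxHeartbeats 800000 in
theorem avgSumRate_isBigO_rpow_mul_log_sq (hP : 0 < P) (hr0 : 0 ≤ r) (hr1 : r < 1)
    (hpr : p = 1 - r)
    (hK : ∀ M : ℕ, 1 ≤ M → |(K M : ℝ) - (M : ℝ) ^ p| < 1)
    (hindep : ∀ M : ℕ, 1 ≤ M → iIndepFun (u M) (μ M))
    (hunif : ∀ M : ℕ, 1 ≤ M → ∀ k, pdf.IsUniform (u M k)
      (Set.Icc (-((M : ℝ) ^ (-r) / 2)) ((M : ℝ) ^ (-r) / 2)) (μ M) volume) :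
    (fun M : ℕ => avgSumRate (μ M) P σ M (u M)) =O[atTop]
      (fun M : ℕ => (M : ℝ) ^ r * Real.log M ^ 2) := by
  have hp0 : 0 < p := by linarith
  have h2 : 0 < Real.log 2 := Real.log_pos one_lt_two
  set C := (Real.log (1 + P / σ ^ 2) / Real.log 2 + 1) / Real.log 2 with hC
  have hC0 : 0 ≤ C := by
    have : 0 ≤ Real.log (1 + P / σ ^ 2) :=
      Real.log_nonneg (le_add_of_nonneg_right (by positivity))
    positivity
  -- Here `6 = 2 · 3`, from the pair (`n + 1 = 2`) and `e^θ ≤ 3`; the outer `2` is from `K ≤ 2 M^p`.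
  set D := 2 * (P / σ ^ 2 * (6 * (128 * Real.pi)) ^ 2 / Real.log 2) with hD
  refine IsBigO.of_bound (D + 2 * C) ?_
  have hevp := ((tendsto_rpow_atTop hp0).comp
    tendsto_natCast_atTop_atTop).eventually_ge_atTop 4
  have hevlog := (Real.tendsto_log_atTop.comp
    tendsto_natCast_atTop_atTop).eventually_ge_atTop 1
  have hevo := (((isLittleO_log_rpow_atTop hp0).comp_tendsto
    tendsto_natCast_atTop_atTop).bound (show (0 : ℝ) < 1 / (128 * Real.pi) by positivity))
  filter_upwards [eventually_ge_atTop 2, hevp, hevlog, hevo] with M hM2 hMp hlog1 ho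
  simp only [Function.comp_apply] at hMp hlog1 ho
  have hM : 1 ≤ M := by omega
  have hM' : (1 : ℝ) ≤ M := by exact_mod_cast hM
  have hM0 : (0 : ℝ) < M := by linarith
  have hKlow := half_le_natCast_of_abs_sub_lt (by linarith) (hK M hM)
  have hKup := natCast_le_two_mul_of_abs_sub_lt (by linarith) (hK M hM)
  have hpM : (M : ℝ) ^ p ≤ M := by
    simpa using Real.rpow_le_rpow_of_exponent_le hM' (show p ≤ 1 by linarith)
  have hr : (M : ℝ) ^ r * (M : ℝ) ^ p = M := by
    rw [← Real.rpow_add hM0, hpr, add_sub_cancel, Real.rpow_one]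
  have hr1' : 1 ≤ (M : ℝ) ^ r := Real.one_le_rpow hM' hr0
  have hW : (M : ℝ) ^ (-r) = ((M : ℝ) ^ r)⁻¹ := Real.rpow_neg hM0.le r
  have hlogb := logb_one_add_mul_le (show 0 ≤ P / σ ^ 2 by positivity) hM2
  have hexp : Real.exp (-(2 * Real.log M)) = ((M : ℝ) ^ 2)⁻¹ := by
    rw [Real.exp_neg, two_mul, Real.exp_add, Real.exp_log hM0, sq]
  rw [Real.norm_of_nonneg (by linarith), Real.norm_of_nonneg (by linarith)] at ho
  rw [Real.norm_of_nonneg (avgSumRate_nonneg hP.le σ hM), Real.norm_of_nonneg (by positivity)]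
  set L := Real.log M with hL
  set y := (M : ℝ) ^ p with hy
  set z := (M : ℝ) ^ r with hz
  set k : ℝ := (K M : ℝ) with hk
  have hθ1 : 128 * Real.pi * L / y ≤ 1 := by
    rw [div_le_one (by linarith)]
    rw [one_div, inv_mul_eq_div, le_div_iff₀ (by positivity)] at ho
    linarith
  have hx1 : 1 ≤ k ^ 2 / (8 * L) := by
    have hpi := Real.pi_gt_three
    rw [div_le_one (by linarith)] at hθ1
    rw [le_div_iff₀ (by linarith)]
    nlinarith
  -- The number of cells is as large as the birthday bound allows with failure probability at most
  -- `M⁻²`: `k(k-1) ≥ k²/2 ≥ 4L⌊x⌋₊`. Since `k ≥ y/2` and `⌊x⌋₊ ≥ x/2`, there are at least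
  -- `y²/(64L)` cells, whence `128π` in `θ`.
  set x := k ^ 2 / (8 * L) with hx
  have hB : 0 < ⌊x⌋₊ := Nat.floor_pos.2 hx1
  have hBx : (⌊x⌋₊ : ℝ) ≤ x := Nat.floor_le (by linarith)
  have hBx' : x / 2 ≤ ⌊x⌋₊ := by
    have h3 := Nat.lt_floor_add_one x
    have h4 : (1 : ℝ) ≤ ⌊x⌋₊ := by exact_mod_cast hB
    linarith
  have hB0 : (0 : ℝ) < ⌊x⌋₊ := by exact_mod_cast hB
  have hBy : y ^ 2 / (64 * L) ≤ ⌊x⌋₊ := by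
    refine le_trans ?_ hBx'
    rw [hx, div_div, div_le_div_iff₀ (by linarith) (by linarith)]
    have : y ^ 2 / 4 ≤ k ^ 2 := by nlinarith
    nlinarith
  have hθ : 2 * Real.pi * M * ((M : ℝ) ^ (-r) / ⌊x⌋₊) ≤ 128 * Real.pi * L / y := by
    rw [hW, ← hr]
    calc 2 * Real.pi * (z * y) * (z⁻¹ / ⌊x⌋₊)
        = 2 * Real.pi * y / ⌊x⌋₊ := by field_simp
      _ ≤ 2 * Real.pi * y / (y ^ 2 / (64 * L)) := by gcongr
      _ = _ := by field_simp; norm_num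
  have hθ0 : 0 ≤ 128 * Real.pi * L / y := by positivity
  have hbad : 2 * L ≤ k * (k - 1) / (2 * ⌊x⌋₊) := by
    rw [le_div_iff₀ (by positivity)]
    have h5 : L * x = k ^ 2 / 8 := by rw [hx]; field_simp
    have h6 : L * ⌊x⌋₊ ≤ L * x := by gcongr
    nlinarith
  refine (avgSumRate_le_of_cells hP.le σ hM (by positivity) (hindep M hM) (hunif M hM) hB
    hθ).trans ?_
  set θ := 128 * Real.pi * L / y with hθdef
  have hfirst : k * (P / σ ^ 2 * M * (2 * (θ * Real.exp θ)) ^ 2 / Real.log 2) ≤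
      D * (z * L ^ 2) := by
    have he : Real.exp θ ≤ 3 :=
      (Real.exp_le_exp.2 hθ1).trans (by linarith [Real.exp_one_lt_d9])
    calc k * (P / σ ^ 2 * M * (2 * (θ * Real.exp θ)) ^ 2 / Real.log 2)
        ≤ (2 * y) * (P / σ ^ 2 * M * (2 * (θ * 3)) ^ 2 / Real.log 2) := by gcongr
      _ = D * (z * L ^ 2) := by
        rw [← hr, hθdef, hD]
        field_simp
        ring
  have hsecond : k * Real.logb 2 (1 + P / σ ^ 2 * M) *
      Real.exp (-(k * (k - 1) / (2 * ⌊x⌋₊))) ≤ 2 * C * (z * L ^ 2) := by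
    calc k * Real.logb 2 (1 + P / σ ^ 2 * M) * Real.exp (-(k * (k - 1) / (2 * ⌊x⌋₊)))
        ≤ (2 * M) * (C * L) * Real.exp (-(2 * L)) := by
          gcongr
          · exact Real.logb_nonneg one_lt_two (le_add_of_nonneg_right (by positivity))
          · linarith
      _ = 2 * C * (L * (M : ℝ)⁻¹) := by
          rw [hexp]
          field_simp
      _ ≤ 2 * C * (z * L ^ 2) := by
          refine mul_le_mul_of_nonneg_left ?_ (by positivity)
          have h7 : (M : ℝ)⁻¹ ≤ 1 := inv_le_one_of_one_le₀ hM'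
          calc L * (M : ℝ)⁻¹ ≤ L * 1 := by gcongr
            _ ≤ L ^ 2 := by nlinarith
            _ ≤ z * L ^ 2 := le_mul_of_one_le_left (by positivity) hr1'
  linarith

end Scaling

end ZFDownlink

/-! ### Assembly of the regimes. -/

theorem theorem1 {Ω : ℕ → Type*} [∀ M, MeasurableSpace (Ω M)]
    (μ : ∀ M, Measure (Ω M)) [∀ M, IsProbabilityMeasure (μ M)]
    -- transmit power, noise standard deviation, scaling exponents
    (P σ p r : ℝ) (hP : 0 < P) (hσ : 0 < σ)
    (hp0 : 0 ≤ p) (hp1 : p ≤ 1) (hr0 : 0 ≤ r) (hr1 : r < 1)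
    -- `K = M ^ p` users, up to rounding to an adjacent integer
    (K : ℕ → ℕ) (hK : ∀ M : ℕ, 1 ≤ M → |(K M : ℝ) - (M : ℝ) ^ p| < 1)
    -- cell size and altitude
    (R H : ℕ → ℝ) (hH : ∀ M : ℕ, 1 ≤ M → 0 < H M)
    (hRH : ∀ M : ℕ, 1 ≤ M → R M / H M = (M : ℝ) ^ (-r))
    -- spatial frequencies of the users, i.i.d. uniform on `[-R/(2H), R/(2H)]`
    (u : ∀ M : ℕ, Fin (K M) → Ω M → ℝ)
    (hindep : ∀ M : ℕ, 1 ≤ M → iIndepFun (u M) (μ M))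
    (hunif : ∀ M : ℕ, 1 ≤ M → ∀ k,
      pdf.IsUniform (u M k) (Set.Icc (-(R M / (2 * H M))) (R M / (2 * H M))) (μ M) volume) :
    -- the averages are well defined
    (∀ M : ℕ, 1 ≤ M →
      Integrable (fun ω => ZFDownlink.zfSumRate P σ M (fun k => u M k ω)) (μ M)) ∧
    -- sparse regime
    (p < 1 - r →
      (fun M : ℕ => ZFDownlink.avgSumRate (μ M) P σ M (u M)) =O[atTop]
        (fun M : ℕ => (M : ℝ) ^ p * Real.log M)) ∧
    -- critical regime
    (p = 1 - r →
      (r < 1 / 2 → ∃ ε : ℕ → ℝ, Tendsto ε atTop (𝓝 0) ∧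
        (fun M : ℕ => ZFDownlink.avgSumRate (μ M) P σ M (u M)) =O[atTop]
          (fun M : ℕ => (M : ℝ) ^ (r + ε M))) ∧
      (r = 1 / 2 → ∃ ε : ℕ → ℝ, Tendsto ε atTop (𝓝 0) ∧
        (fun M : ℕ => ZFDownlink.avgSumRate (μ M) P σ M (u M)) =O[atTop]
          (fun M : ℕ => (M : ℝ) ^ (1 / 2 + ε M))) ∧
      (1 / 2 < r → ∃ ε : ℕ → ℝ, Tendsto ε atTop (𝓝 0) ∧
        (fun M : ℕ => ZFDownlink.avgSumRate (μ M) P σ M (u M)) =O[atTop]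
          (fun M : ℕ => (M : ℝ) ^ (1 - r + ε M) * Real.log M))) ∧
    -- dense regime
    (1 - r < p →
      Tendsto (fun M : ℕ => ZFDownlink.avgSumRate (μ M) P σ M (u M)) atTop (𝓝 0)) := by
  have hunif' : ∀ M : ℕ, 1 ≤ M → ∀ k, pdf.IsUniform (u M k)
      (Set.Icc (-((M : ℝ) ^ (-r) / 2)) ((M : ℝ) ^ (-r) / 2)) (μ M) volume := by
    intro M hM k
    have h : R M / (2 * H M) = (M : ℝ) ^ (-r) / 2 := by
      rw [← hRH M hM, div_div, mul_comm]
    rw [← h]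
    exact hunif M hM k
  have hlog := ZFDownlink.avgSumRate_isBigO_rpow_mul_log (σ := σ) hP hp0 hK hunif'
  refine ⟨fun M hM => ?_, fun _ => hlog, fun hpr => ⟨fun _ => ?_, fun hr => ?_, fun _ => ?_⟩,
    fun hpr => ZFDownlink.avgSumRate_tendsto_zero hP hp1 hr1 hpr hK hunif'⟩
  · have hM0 : (0 : ℝ) < M := by exact_mod_cast hM
    exact ZFDownlink.integrable_zfSumRate hP.le σ hM (by positivity) (hunif' M hM)
  · obtain ⟨ε, hε, hεlog⟩ := ZFDownlink.exists_rpow_eq_log_pow 2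
    refine ⟨ε, hε, (ZFDownlink.avgSumRate_isBigO_rpow_mul_log_sq hP hr0 hr1 hpr hK hindep
      hunif').congr' EventuallyEq.rfl ?_⟩
    filter_upwards [eventually_ge_atTop 2] with M hM
    have hM0 : (0 : ℝ) < M := by exact_mod_cast (by omega : 0 < M)
    rw [Real.rpow_add hM0, hεlog M hM]
  -- At `r = 1/2` the single-user bound is `M^(1/2) log M`, one logarithm to absorb.
  · obtain ⟨ε, hε, hεlog⟩ := ZFDownlink.exists_rpow_eq_log_pow 1
    refine ⟨ε, hε, hlog.congr' EventuallyEq.rfl ?_⟩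
    filter_upwards [eventually_ge_atTop 2] with M hM
    have hM0 : (0 : ℝ) < M := by exact_mod_cast (by omega : 0 < M)
    have hp : p = 1 / 2 := by linarith
    rw [Real.rpow_add hM0, hεlog M hM, pow_one, hp]
  -- For `r > 1/2` the target keeps its logarithm, so `ε = 0` suffices.
  · refine ⟨fun _ => 0, tendsto_const_nhds, ?_⟩
    simpa only [add_zero, hpr] using hlog
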